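/- Let $K$ be any infinite field (of arbitrary characteristic). For $i=1,\dots,t$ let $L_i/K$ be a finite separable extension of degree $d_i$ (the $L_i$ need not be distinct), and assume $d_1+\dots+d_t=9$. Fix an integer $N>1$. For an extension $L/K$ and a curve $X/K$, a point of $X(L)$ is called new if it does not belong to $X(M)$ for any proper subfield $K\subseteq M\subsetneq L$. Then there exist infinitely many elliptic curves $X/K$, pairwise non-isomorphic over $\overline{K}$, such that for each of them there are new points $P_1\in X(L_1),\dots,P_t\in X(L_t)$ with the following two properties. (a) If $Q_i$ denotes the image of $P_i:\operatorname{Spec} L_i\to X$, then $Q_1,\dots,Q_t$ are $t$ distinct closed points of $X$. (b) For every finite extension $F/K$ with $K$-linear field embeddings $L_i\hookrightarrow F$ ($i=1,\dots,t$), the image of at least one of the $P_i$ in the group $X(F)$ has infinite order or finite order larger than $N$. -/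

import Mathlib

universe u v w

namespace NewPoints

/-- The set `E(L)` of `L`-rational points (including the point at infinity, the origin) of a
Weierstrass curve `E` over `K`, for an extension `L` of `K`. It is a group when `E` is elliptic. -/
abbrev RatPoint {K : Type*} [Field K] (E : WeierstrassCurve K) (L : Type*) [Field L]
    [Algebra K L] : Type _ :=
  WeierstrassCurve.Affine.Point (E.baseChange L)

open scoped Classical in
/-- The homomorphism `E(L) → E(M)` induced by a `K`-embedding `L → M`. -/
noncomputable def mapPoint {K L M : Type*} [Field K] [Field L] [Field M] [Algebra K L]
    [Algebra K M] (E : WeierstrassCurve K) (f : L →ₐ[K] M) : RatPoint E L →+ RatPoint E M :=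
  WeierstrassCurve.Affine.Point.map (W' := E) f

/-- A point of `E(L)` is new if it does not come from `E(M)` for any proper subfield
`K ⊆ M ⊊ L`. -/
def IsNew {K L : Type*} [Field K] [Field L] [Algebra K L] (E : WeierstrassCurve K)
    (P : RatPoint E L) : Prop :=
  ∀ M : IntermediateField K L, P ∈ Set.range (mapPoint E M.val) → M = ⊤

/-- The closed point of `E` which is the image of `P : Spec L → E`, for `L/K` algebraic, given as
the orbit of geometric points of `E` lying over it: the conjugates `σ(P)` in `E(K̄)`. Two
points (over possibly different algebraic extensions) have the same image in `E` if and only if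
these sets coincide. -/
def closedPoint {K L : Type*} [Field K] [Field L] [Algebra K L] (E : WeierstrassCurve K)
    (P : RatPoint E L) : Set (RatPoint E (AlgebraicClosure K)) :=
  Set.range fun σ : L →ₐ[K] AlgebraicClosure K => mapPoint E σ P

/-- `E` and `E'` are isomorphic over the algebraic closure `K̄` of `K`: some admissible change of
variables over `K̄` transforms one Weierstrass equation into the other. -/
def GeomIso {K : Type*} [Field K] (E E' : WeierstrassCurve K) : Prop :=
  ∃ C : WeierstrassCurve.VariableChange (AlgebraicClosure K),
    C • E.baseChange (AlgebraicClosure K) = E'.baseChange (AlgebraicClosure K)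

open scoped Classical in
/-- The point `Q` of the group `E(F)` has infinite order, or finite order larger than `N`. -/
def OrderGT {K F : Type*} [Field K] [Field F] [Algebra K F] (E : WeierstrassCurve K)
    (N : ℕ) (Q : RatPoint E F) : Prop :=
  ¬ IsOfFinAddOrder Q ∨ N < addOrderOf Q

end NewPoints

/-!
Put `A = ∏ L i`, an étale algebra of degree `9` over `K`, and let `θ` be an element of `A` of trace
zero, with characteristic polynomial `g = T⁹ + g₇T⁷ + ⋯ + g₀`. As `g` has no term of degree `8`, its
value at `T` is the restriction to the cuspidal cubic `u = T`, `v = T³` of the cubic form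
`v³ + g₇uv² + g₆v² + g₅u²v + g₄uv + g₃v + g₂u² + g₁u + g₀`. The plane cubic so defined passes through
the nine conjugate points `(θ, θ³)`, and it has the rational point `(1 : 0 : 0)` at infinity. With
that point as origin, Nagell's reduction turns it into a Weierstrass curve (`CuspidalFamily.curve`), in every
characteristic, whose coefficients are polynomials in the `gᵢ`. The points of this curve over the
`L i` determine `θ` (`CuspidalFamily.recover_point`), so they are new and lie over distinct closed
points if the nine conjugates of `θ` are distinct.

All that remains is a list of conditions, each the nonvanishing of a polynomial in the conjugates of
`θ`. By Dedekind's independence of embeddings and the infinitude of `K`, the elements of `A` are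
Zariski dense in the affine space of all families of nine elements of the algebraic closure
(`exists_of_eventually_zariskiGeneric`), so it is enough to satisfy each condition at one point of
that space, that is, for one polynomial `g` over the algebraic closure.

If a point has order at most `N`, two of its multiples by `2 ^ k` with `k ≤ N` coincide, which gives
an algebraic relation between iterates of the duplication formula on the `x`-line. This relation
fails when the plane cubic degenerates to a suitable union of a line and a conic: the Weierstrass
model is then nodal, and duplication becomes the polynomial map `f ↦ f² + 4f` in the coordinate
`f = b₂ / x`, which can be given any nonzero value (`CuspidalFamily.exists_nodal`). At this nodal curve
`c₄ ≠ 0` and `Δ = 0`, so `c₄³ - jΔ ≠ 0` for every `j`: the `j`-invariant avoids any given finite set,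
and infinitely many geometric isomorphism classes occur.
-/

/-! ### Doubling on the `x`-line -/

namespace WeierstrassCurve

/-- The duplication formula on the `x`-line of a Weierstrass curve, in homogeneous coordinates
`(N : D)` with `x = N / D`. -/
def xDouble {R : Type*} [CommRing R] (W : WeierstrassCurve R) (p : R × R) : R × R :=
  (p.1 ^ 4 - W.b₄ * p.1 ^ 2 * p.2 ^ 2 - 2 * W.b₆ * p.1 * p.2 ^ 3 - W.b₈ * p.2 ^ 4,
    p.2 * (4 * p.1 ^ 3 + W.b₂ * p.1 ^ 2 * p.2 + 2 * W.b₄ * p.1 * p.2 ^ 2 + W.b₆ * p.2 ^ 3))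

theorem map_iterate_xDouble {R S : Type*} [CommRing R] [CommRing S] (f : R →+* S)
    (W : WeierstrassCurve R) (k : ℕ) (p : R × R) :
    (W.map f).xDouble^[k] (Prod.map f f p) = Prod.map f f (W.xDouble^[k] p) :=
  ((Function.Semiconj.iterate_right (f := Prod.map f f) (ga := W.xDouble)
    (gb := (W.map f).xDouble) (fun q => by
      have h2 : f 2 = 2 := map_ofNat f 2
      have h4 : f 4 = 4 := map_ofNat f 4
      simp [xDouble, h2, h4]) k) p).symm

/-- A pair `(N, D)` with `x(Q) * D = N` for an affine point `Q`, and with `D = 0` for the point at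
infinity. The pair `(0, 0)` is deliberately not excluded: then the relation is stable under
doubling without any coprimality argument. -/
def RepresentsX {F : Type*} [Field F] {W : WeierstrassCurve F} :
    W.toAffine.Point → F × F → Prop
  | .zero, p => p.2 = 0
  | .some x _ _, p => p.1 = x * p.2

theorem RepresentsX.cross_mul_eq {F : Type*} [Field F] {W : WeierstrassCurve F}
    {Q : W.toAffine.Point} {p q : F × F} (hp : RepresentsX Q p) (hq : RepresentsX Q q) :
    p.1 * q.2 = q.1 * p.2 := by
  cases Q with
  | zero => simp_all [RepresentsX]
  | some x y h =>
    simp only [RepresentsX] at hp hq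
    rw [hp, hq]; ring

theorem RepresentsX.double {F : Type*} [Field F] [DecidableEq F] {W : WeierstrassCurve F}
    {Q : W.toAffine.Point} {p : F × F} (hp : RepresentsX Q p) :
    RepresentsX (Q + Q) (W.xDouble p) := by
  obtain ⟨n, d⟩ := p
  cases Q with
  | zero =>
    simp only [RepresentsX] at hp
    rw [← Affine.Point.zero_def, add_zero, Affine.Point.zero_def]
    simp [RepresentsX, xDouble, hp]
  | some x y h =>
    simp only [RepresentsX] at hp
    have he := (Affine.equation_iff ..).mp h.left
    by_cases hy : y = W.toAffine.negY x y
    · rw [Affine.Point.add_self_of_Y_eq hy, Affine.Point.zero_def]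
      simp only [RepresentsX, xDouble, hp]
      -- the second coordinate is `D ^ 4 * ψ₂ ^ 2`, where `ψ₂ = 2 * y + a₁ * x + a₃`
      rw [Affine.negY] at hy
      simp only [b₂, b₄, b₆]
      linear_combination (-4 * d ^ 4) * he +
        d ^ 4 * (2 * y + W.a₁ * x + W.a₃) * hy
    · rw [Affine.Point.add_self_of_Y_ne hy]
      simp only [RepresentsX, xDouble, hp]
      rw [Affine.slope_of_Y_ne rfl hy, Affine.addX, Affine.negY]
      rw [Affine.negY, ← ne_eq, ← sub_ne_zero] at hy
      have hy' : 2 * y + W.a₁ * x + W.a₃ ≠ 0 := fun h0 => hy (by linear_combination h0)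
      have e : y - (-y - W.a₁ * x - W.a₃) = 2 * y + W.a₁ * x + W.a₃ := by ring
      rw [e]
      generalize ht : 2 * y + W.a₁ * x + W.a₃ = t at hy'
      have ht2 : 4 * x ^ 3 + W.b₂ * x ^ 2 + 2 * W.b₄ * x + W.b₆ = t ^ 2 := by
        rw [← ht]; simp only [b₂, b₄, b₆]; linear_combination (-4) * he
      have hd : d * (4 * (x * d) ^ 3 + W.b₂ * (x * d) ^ 2 * d + 2 * W.b₄ * (x * d) * d ^ 2 +
          W.b₆ * d ^ 3) = d ^ 4 * t ^ 2 := by linear_combination d ^ 4 * ht2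
      rw [hd]
      field_simp
      subst ht
      simp only [b₄, b₆, b₈]
      linear_combination d ^ 4 * (W.a₁ ^ 2 + 4 * W.a₂ + 8 * x) * he

/-- If the `x`-coordinates of `2 ^ k • Q` for `k ≤ N` are pairwise distinct, the order of `Q`
exceeds `N`. -/
theorem not_isOfFinAddOrder_or_lt_addOrderOf {F : Type*} [Field F] [DecidableEq F]
    {W : WeierstrassCurve F} {Q : W.toAffine.Point} {p : F × F} (hp : RepresentsX Q p) {N : ℕ}
    (h : ∀ j ≤ N, ∀ i < j, (W.xDouble^[i] p).1 * (W.xDouble^[j] p).2 ≠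
      (W.xDouble^[j] p).1 * (W.xDouble^[i] p).2) :
    ¬ IsOfFinAddOrder Q ∨ N < addOrderOf Q := by
  by_contra! hcon
  obtain ⟨hfin, hle⟩ := hcon
  have hrep (k : ℕ) : RepresentsX (2 ^ k • Q) (W.xDouble^[k] p) := by
    induction k with
    | zero => simpa using hp
    | succ k ih =>
      rw [Function.iterate_succ_apply', pow_succ, mul_nsmul, two_nsmul]
      simpa using ih.double
  -- two of the multiples `2 ^ k • Q` with `k ≤ N` coincide, by the pigeonhole principle
  obtain ⟨i, hi, j, hj, hij, heq⟩ := Finset.exists_ne_map_eq_of_card_lt_of_maps_to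
    (s := Finset.range (N + 1)) (t := Finset.range (addOrderOf Q))
    (f := fun k => 2 ^ k % addOrderOf Q) (by simpa using Nat.lt_succ_of_le hle)
    (fun k _ => by simpa using Nat.mod_lt _ hfin.addOrderOf_pos)
  have key : (2 ^ i) • Q = (2 ^ j) • Q := by
    rw [← mod_addOrderOf_nsmul Q (2 ^ i), ← mod_addOrderOf_nsmul Q (2 ^ j)]
    exact congrArg (· • Q) heq
  simp only [Finset.mem_range, Nat.lt_succ_iff] at hi hj
  rcases lt_or_gt_of_ne hij with hlt | hlt
  · exact h j hj i hlt ((hrep i).cross_mul_eq (key ▸ hrep j))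
  · exact h i hi j hlt ((hrep j).cross_mul_eq (key ▸ hrep i))

end WeierstrassCurve

/-! ### The family of Weierstrass curves -/

namespace CuspidalFamily

open Polynomial

section Ring

variable {R S : Type*} [CommRing R] [CommRing S]

/-- Let `u` and `v` satisfy the plane cubic equation
`v³ + g₇uv² + g₆v² + g₅u²v + g₄uv + g₃v + g₂u² + g₁u + g₀ = 0`, which is `g(T) = 0` along the
cuspidal cubic `u = T`, `v = T³`. In terms of `s = g₅v + g₂` and `g₅²u`, after clearing denominators,
the equation is quadratic in the second variable with leading coefficient `s`, linear coefficient
`q₀ + q₁s + g₇s²` and constant coefficient `r₀ + r₁s + r₂s² + g₅s³`. This is `q₀`. -/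
def q₀ (g : R[X]) : R :=
  g.coeff 7 * g.coeff 2 ^ 2 - g.coeff 4 * g.coeff 5 * g.coeff 2 + g.coeff 1 * g.coeff 5 ^ 2

/-- The coefficient `q₁` of the plane cubic in the coordinates described at `q₀`. -/
def q₁ (g : R[X]) : R := g.coeff 4 * g.coeff 5 - 2 * g.coeff 2 * g.coeff 7

/-- The coefficient `r₀` of the plane cubic in the coordinates described at `q₀`. -/
def r₀ (g : R[X]) : R :=
  g.coeff 5 * (-g.coeff 2 ^ 3 + g.coeff 6 * g.coeff 5 * g.coeff 2 ^ 2 -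
    g.coeff 3 * g.coeff 5 ^ 2 * g.coeff 2 + g.coeff 0 * g.coeff 5 ^ 3)

/-- The coefficient `r₁` of the plane cubic in the coordinates described at `q₀`. -/
def r₁ (g : R[X]) : R :=
  g.coeff 5 * (3 * g.coeff 2 ^ 2 - 2 * g.coeff 6 * g.coeff 5 * g.coeff 2 +
    g.coeff 3 * g.coeff 5 ^ 2)

/-- The coefficient `r₂` of the plane cubic in the coordinates described at `q₀`. -/
def r₂ (g : R[X]) : R := g.coeff 5 * (-3 * g.coeff 2 + g.coeff 6 * g.coeff 5)

/-- The coefficient of `s` in the form `secondTangent`. It is chosen, as is `r₀ * q₀ ^ 2`, so that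
the substitution in Nagell's reduction kills the terms which prevent a Weierstrass form. -/
def shift (g : R[X]) : R := r₀ g ^ 2 - q₀ g * q₁ g * r₀ g + r₁ g * q₀ g ^ 2

/-- The Weierstrass model, with denominators cleared, of the plane cubic attached to the monic
polynomial `g` of degree `9` without a term of degree `8`. -/
def curve (g : R[X]) : WeierstrassCurve R where
  a₁ := 2 * r₀ g - q₀ g * q₁ g
  a₂ := 2 * shift g - g.coeff 7 * q₀ g ^ 3
  a₃ := 2 * r₀ g * shift g - g.coeff 7 * r₀ g * q₀ g ^ 3 - q₁ g * shift g * q₀ g + r₂ g * q₀ g ^ 4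
  a₄ := shift g ^ 2 - g.coeff 7 * shift g * q₀ g ^ 3 + g.coeff 5 * q₀ g ^ 6
  a₆ := 0

/-- The value at the point `(θ, θ³)` of the linear form `s` that defines the tangent to the plane
cubic at its rational point `(1 : 0 : 0)` at infinity. -/
def tangent (g : R[X]) (θ : R) : R := g.coeff 5 * θ ^ 3 + g.coeff 2

/-- The value at the point `(θ, θ³)` of the linear form, suitably scaled, that defines the tangent to
the plane cubic at the third point on its tangent at `(1 : 0 : 0)`. Up to sign, its quotient by
`tangent` is the function `x`, whose double pole at `(1 : 0 : 0)` makes that point the origin. -/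
def secondTangent (g : R[X]) (θ : R) : R :=
  q₀ g ^ 3 * (g.coeff 5 ^ 2 * θ) + r₀ g * q₀ g ^ 2 + shift g * tangent g θ

/-- Homogeneous coordinates of the image in the `x`-line of `2 ^ n` times the point of `curve g` with
parameter `θ`. -/
def multipleX (g : R[X]) (θ : R) (n : ℕ) : R × R :=
  (curve g).xDouble^[n] (-secondTangent g θ, tangent g θ)

variable (f : R →+* S) (g : R[X]) (θ : R)

theorem map_q₀ : q₀ (g.map f) = f (q₀ g) := by simp [q₀]

theorem map_r₀ : r₀ (g.map f) = f (r₀ g) := by simp [r₀]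

theorem map_shift : shift (g.map f) = f (shift g) := by
  have h2 : f 2 = 2 := map_ofNat f 2
  have h3 : f 3 = 3 := map_ofNat f 3
  simp [shift, q₀, q₁, r₀, r₁, h2, h3]

theorem map_curve : curve (g.map f) = (curve g).map f := by
  have h2 : f 2 = 2 := map_ofNat f 2
  have h3 : f 3 = 3 := map_ofNat f 3
  ext <;> simp [curve, map_shift, map_q₀, map_r₀, q₁, r₂, h2, h3]

theorem map_tangent : tangent (g.map f) (f θ) = f (tangent g θ) := by simp [tangent]

theorem map_secondTangent : secondTangent (g.map f) (f θ) = f (secondTangent g θ) := by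
  simp [secondTangent, map_shift, map_q₀, map_r₀, map_tangent]

theorem map_multipleX (n : ℕ) :
    multipleX (g.map f) (f θ) n = Prod.map f f (multipleX g θ n) := by
  rw [multipleX, multipleX, ← WeierstrassCurve.map_iterate_xDouble, map_curve, Prod.map_apply,
    map_neg, map_secondTangent, map_tangent]

end Ring

section Field

variable {F : Type*} [Field F] {g : F[X]} {θ : F}

/-- The `x`-coordinate of the point of `curve g` attached to the root `θ` of `g`. -/
def pointX (g : F[X]) (θ : F) : F := -secondTangent g θ / tangent g θ

/-- The `y`-coordinate of the point of `curve g` attached to the root `θ` of `g`. -/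
def pointY (g : F[X]) (θ : F) : F := q₀ g ^ 2 * secondTangent g θ / tangent g θ ^ 2

/-- A root of `g` gives a point of `curve g`. -/
theorem equation_point (hdeg : g.natDegree = 9) (hm : g.Monic) (h8 : g.coeff 8 = 0)
    (hθ : g.eval θ = 0) (hs : tangent g θ ≠ 0) :
    (curve g).toAffine.Equation (pointX g θ) (pointY g θ) := by
  rw [Polynomial.eval_eq_sum_range, hdeg] at hθ
  have h9 : g.coeff 9 = 1 := by rw [← hdeg]; exact hm
  simp only [Finset.sum_range_succ, Finset.sum_range_zero, h8, h9] at hθ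
  -- the plane cubic, in the coordinates `u = g₅ ^ 2 * θ` and `s = tangent g θ`
  have hrel : tangent g θ * (g.coeff 5 ^ 2 * θ) ^ 2 + (q₀ g + q₁ g * tangent g θ +
      g.coeff 7 * tangent g θ ^ 2) * (g.coeff 5 ^ 2 * θ) + (r₀ g + r₁ g * tangent g θ +
      r₂ g * tangent g θ ^ 2 + g.coeff 5 * tangent g θ ^ 3) = 0 := by
    simp only [tangent, q₀, q₁, r₀, r₁, r₂]
    linear_combination g.coeff 5 ^ 4 * hθ
  have hz : secondTangent g θ = q₀ g ^ 3 * (g.coeff 5 ^ 2 * θ) + r₀ g * q₀ g ^ 2 +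
    shift g * tangent g θ := rfl
  have hd : shift g = r₀ g ^ 2 - q₀ g * q₁ g * r₀ g + r₁ g * q₀ g ^ 2 := rfl
  rw [WeierstrassCurve.Affine.equation_iff]
  simp only [curve, pointX, pointY]
  generalize tangent g θ = s at *
  generalize secondTangent g θ = z at *
  generalize g.coeff 5 ^ 2 * θ = u at *
  generalize shift g = d at *
  generalize q₀ g = a at *
  generalize q₁ g = b at *
  generalize r₀ g = r at *
  generalize r₁ g = r' at *
  field_simp
  subst hz
  subst hd
  linear_combination (a ^ 3 * u + r * a ^ 2 + (r ^ 2 - a * b * r + r' * a ^ 2) * s) * a ^ 6 * hrel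

/-- The parameter `θ` as a rational function of the coordinates of the attached point. Here
`q₀ g ^ 2 * x / y` is the negative of `tangent g θ`. -/
def recover (g : F[X]) (x y : F) : F :=
  (x * (q₀ g ^ 2 * x / y) - r₀ g * q₀ g ^ 2 + shift g * (q₀ g ^ 2 * x / y)) /
    (q₀ g ^ 3 * g.coeff 5 ^ 2)

theorem map_recover {F' : Type*} [Field F'] (f : F →+* F') (g : F[X]) (x y : F) :
    recover (g.map f) (f x) (f y) = f (recover g x y) := by
  simp [recover, map_q₀, map_r₀, map_shift]

theorem recover_point (h5 : g.coeff 5 ≠ 0) (hq : q₀ g ≠ 0) (hs : tangent g θ ≠ 0)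
    (hz : secondTangent g θ ≠ 0) : recover g (pointX g θ) (pointY g θ) = θ := by
  have hx : q₀ g ^ 2 * pointX g θ / pointY g θ = -tangent g θ := by
    rw [pointX, pointY]; field_simp
  rw [recover, hx, pointX, div_eq_iff (by positivity)]
  have hz' : secondTangent g θ = q₀ g ^ 3 * (g.coeff 5 ^ 2 * θ) + r₀ g * q₀ g ^ 2 +
    shift g * tangent g θ := rfl
  field_simp
  rw [hz']
  ring

end Field

end CuspidalFamily

/-! ### A nodal and a smooth member of the family -/

namespace CuspidalFamily

open Polynomial

/-- The monic polynomial `T ^ 9 + c 7 * T ^ 7 + ⋯ + c 0`, without a term of degree `8`. -/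
noncomputable def nonic {F : Type*} [Field F] (c : Fin 8 → F) : F[X] :=
  X ^ 9 + ∑ i : Fin 8, C (c i) * X ^ (i : ℕ)

section Nonic

variable {F : Type*} [Field F] (c : Fin 8 → F)

theorem nonic_low_degree_lt :
    (∑ i : Fin 8, C (c i) * X ^ (i : ℕ)).degree < ((8 : ℕ) : WithBot ℕ) := by
  refine (degree_sum_le _ _).trans_lt ((Finset.sup_lt_iff (WithBot.bot_lt_coe _)).2 fun i _ => ?_)
  exact (degree_C_mul_X_pow_le _ _).trans_lt (by exact_mod_cast i.2)

theorem nonic_monic : (nonic c).Monic :=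
  monic_X_pow_add ((nonic_low_degree_lt c).trans_le (by norm_num))

theorem nonic_natDegree : (nonic c).natDegree = 9 := by
  refine natDegree_eq_of_degree_eq_some ?_
  rw [nonic, degree_add_eq_left_of_degree_lt] <;> rw [degree_X_pow]
  exact (nonic_low_degree_lt c).trans_le (by norm_num)

theorem nonic_coeff (i : Fin 8) : (nonic c).coeff i = c i := by
  have h : (i : ℕ) ≠ 9 := by omega
  simp [nonic, coeff_X_pow, h, Fin.val_inj]

theorem nonic_coeff_eight : (nonic c).coeff 8 = 0 := by
  rw [nonic, coeff_add, coeff_X_pow, coeff_eq_zero_of_degree_lt (nonic_low_degree_lt c)]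
  simp

end Nonic

/-- On a Weierstrass curve with a node at the origin, the duplication formula for the invariant
`b₂ * D / N = b₂ / x` is the polynomial map `f ↦ f ^ 2 + 4 * f`. -/
theorem iterate_xDouble_of_node {F : Type*} [Field F] {W : WeierstrassCurve F} (h4 : W.b₄ = 0)
    (h6 : W.b₆ = 0) (h8 : W.b₈ = 0) {p : F × F} (hp : p.1 ≠ 0) (k : ℕ) :
    (W.xDouble^[k] p).1 ≠ 0 ∧ W.b₂ * (W.xDouble^[k] p).2 / (W.xDouble^[k] p).1 =
      ((X ^ 2 + C 4 * X : F[X]).comp^[k] X).eval (W.b₂ * p.2 / p.1) := by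
  induction k with
  | zero => simpa using hp
  | succ k ih =>
    obtain ⟨hn, he⟩ := ih
    rw [Function.iterate_succ_apply', Function.iterate_succ_apply', eval_comp, ← he]
    generalize W.xDouble^[k] p = q at *
    simp only [WeierstrassCurve.xDouble, h4, h6, h8]
    refine ⟨by simpa using hn, ?_⟩
    simp
    field_simp
    ring

/-- The union of a line and a conic: the Weierstrass model is nodal, and the conic carries a point
of the family whose multiples by powers of `2` are under control. -/
theorem exists_nodal (F : Type*) [Field F] [IsAlgClosed F] (N : ℕ) :
    ∃ (g : F[X]) (θ : F), g.Monic ∧ g.natDegree = 9 ∧ g.coeff 8 = 0 ∧ g.eval θ = 0 ∧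
      g.coeff 5 ≠ 0 ∧ q₀ g ≠ 0 ∧ tangent g θ ≠ 0 ∧ secondTangent g θ ≠ 0 ∧
      (curve g).Δ = 0 ∧ (curve g).c₄ ≠ 0 ∧
      ∀ j ≤ N, ∀ i < j,
        (multipleX g θ i).1 * (multipleX g θ j).2 ≠ (multipleX g θ j).1 * (multipleX g θ i).2 := by
  let D : ℕ → F[X] := fun k => (X ^ 2 + C 4 * X : F[X]).comp^[k] X
  have hD (k : ℕ) : (D k).natDegree = 2 ^ k := by
    have h2 : (X ^ 2 + C 4 * X : F[X]).natDegree = 2 := by compute_degree!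
    simp [D, natDegree_iterate_comp, h2]
  -- a value whose iterates under `f ↦ f ^ 2 + 4 * f` are distinct: the degrees of the iterates differ
  obtain ⟨f, hf⟩ : ∃ f : F, (X * ∏ j ∈ Finset.range (N + 1), ∏ i ∈ Finset.range j,
      (D i - D j)).eval f ≠ 0 := by
    by_contra! hcon
    have h0 : X * ∏ j ∈ Finset.range (N + 1), ∏ i ∈ Finset.range j, (D i - D j) = 0 :=
      Polynomial.funext fun r => by rw [hcon r, eval_zero]
    simp only [mul_eq_zero, X_ne_zero, false_or, Finset.prod_eq_zero_iff, Finset.mem_range] at h0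
    obtain ⟨j, -, i, hij, h⟩ := h0
    have := congrArg natDegree (sub_eq_zero.1 h)
    rw [hD, hD] at this
    exact hij.ne (Nat.pow_right_injective le_rfl this)
  simp only [eval_mul, eval_X, eval_prod, eval_sub, mul_ne_zero_iff, Finset.prod_ne_zero_iff,
    Finset.mem_range, Nat.lt_succ_iff, sub_ne_zero] at hf
  obtain ⟨hf0, hf⟩ := hf
  -- on the conic, `b₂ / x = α ^ 2 / ((θ ^ 3 + θ) * (θ ^ 3 + θ + α))`, so these equations make it `f`
  obtain ⟨θ, hθ⟩ := IsAlgClosed.exists_root (X ^ 3 + X - C 1 : F[X])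
    (by rw [show (X ^ 3 + X - C 1 : F[X]).degree = 3 by compute_degree!]; norm_num)
  obtain ⟨α, hα⟩ := IsAlgClosed.exists_root (X ^ 2 - C f * X - C f : F[X])
    (by rw [show (X ^ 2 - C f * X - C f : F[X]).degree = 2 by compute_degree!]; norm_num)
  simp only [IsRoot.def, eval_sub, eval_add, eval_mul, eval_pow, eval_X, eval_C] at hθ hα
  have hθ0 : θ ≠ 0 := by rintro rfl; simp at hθ
  have hα0 : α ≠ 0 := by rintro rfl; simp [hf0] at hα
  have hα1 : 1 + α ≠ 0 := fun h => by
    have : α = -1 := by linear_combination h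
    subst this; simp at hα
  obtain ⟨a, ha⟩ : ∃ a : F, a = -θ ^ 3 * (1 + α) := ⟨_, rfl⟩
  have ha0 : a ≠ 0 := by rw [ha]; exact mul_ne_zero (neg_ne_zero.2 (pow_ne_zero _ hθ0)) hα1
  -- `nonic c = (T ^ 6 + T ^ 4 + α * T ^ 3 + a) * (T ^ 3 + T)`
  let c : Fin 8 → F := ![0, a, 0, a, α, 1, α, 2]
  have c0 : (nonic c).coeff 0 = 0 := nonic_coeff c 0
  have c1 : (nonic c).coeff 1 = a := nonic_coeff c 1
  have c2 : (nonic c).coeff 2 = 0 := nonic_coeff c 2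
  have c3 : (nonic c).coeff 3 = a := nonic_coeff c 3
  have c4 : (nonic c).coeff 4 = α := nonic_coeff c 4
  have c5 : (nonic c).coeff 5 = 1 := nonic_coeff c 5
  have c6 : (nonic c).coeff 6 = α := nonic_coeff c 6
  have c7 : (nonic c).coeff 7 = 2 := nonic_coeff c 7
  have hq : q₀ (nonic c) = a := by simp [q₀, c1, c2, c4, c5, c7]
  have hr : r₀ (nonic c) = 0 := by simp [r₀, c0, c2, c3, c5, c6]
  have hd : shift (nonic c) = a ^ 3 := by
    simp [shift, hq, hr, r₁, c2, c3, c5, c6]; ring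
  have hs : tangent (nonic c) θ = θ ^ 3 := by simp [tangent, c5, c2]
  have hz : secondTangent (nonic c) θ = a ^ 3 := by
    simp only [secondTangent, hq, hr, hd, hs, c5]; linear_combination a ^ 3 * hθ
  have hW : curve (nonic c) = ⟨-(a * α), 0, 0, 0, 0⟩ := by
    ext <;> simp only [curve, hq, hr, hd, c5, c7, q₁, r₂, c2, c4, c6] <;> ring
  have b2 : (curve (nonic c)).b₂ = a ^ 2 * α ^ 2 := by
    rw [hW]; simp only [WeierstrassCurve.b₂]; ring
  have b4 : (curve (nonic c)).b₄ = 0 := by rw [hW]; simp [WeierstrassCurve.b₄]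
  have b6 : (curve (nonic c)).b₆ = 0 := by rw [hW]; simp [WeierstrassCurve.b₆]
  have b8 : (curve (nonic c)).b₈ = 0 := by rw [hW]; simp [WeierstrassCurve.b₈]
  refine ⟨nonic c, θ, nonic_monic c, nonic_natDegree c, nonic_coeff_eight c, ?_, ?_, ?_, ?_, ?_,
    ?_, ?_, ?_⟩
  · simp [nonic, Fin.sum_univ_succ, c]
    rw [ha]
    linear_combination θ ^ 3 * (θ ^ 3 + θ) * hθ
  · simp [c5]
  · rwa [hq]
  · rw [hs]; exact pow_ne_zero _ hθ0
  · rw [hz]; exact pow_ne_zero _ ha0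
  · rw [WeierstrassCurve.Δ, b4, b6, b8]; ring
  · rw [WeierstrassCurve.c₄, b4, b2]; simp [ha0, hα0]
  · intro j hj i hij heq
    have hn : ((-a ^ 3, θ ^ 3) : F × F).1 ≠ 0 := neg_ne_zero.2 (pow_ne_zero _ ha0)
    have hb : (curve (nonic c)).b₂ * ((-a ^ 3, θ ^ 3) : F × F).2 / ((-a ^ 3, θ ^ 3) : F × F).1 =
        f := by
      rw [b2, div_eq_iff hn]
      simp only
      rw [ha]
      linear_combination θ ^ 9 * (1 + α) ^ 2 * hα
    obtain ⟨hi0, hi⟩ := iterate_xDouble_of_node b4 b6 b8 hn i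
    obtain ⟨hj0, hj'⟩ := iterate_xDouble_of_node b4 b6 b8 hn j
    rw [hb] at hi hj'
    rw [multipleX, multipleX, hs, hz] at heq
    refine hf j hj i hij (hi.symm.trans (Eq.trans ?_ hj'))
    rw [div_eq_div_iff hi0 hj0]
    linear_combination (-(curve (nonic c)).b₂) * heq

/-- The smooth member of the family. -/
theorem exists_smooth (F : Type*) [Field F] :
    ∃ g : F[X], g.Monic ∧ g.natDegree = 9 ∧ g.coeff 8 = 0 ∧ (curve g).Δ ≠ 0 := by
  -- the curve is `y ^ 2 + β * y = x ^ 3 + x`, of discriminant `-64 - 27 * β ^ 4`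
  obtain ⟨β, hβ⟩ : ∃ β : F, 64 + 27 * β ^ 4 ≠ 0 := by
    by_cases h : (2 : F) = 0
    · refine ⟨1, fun h1 => one_ne_zero (α := F) ?_⟩
      linear_combination h1 - 45 * h
    · refine ⟨0, ?_⟩
      rw [show (64 + 27 * 0 ^ 4 : F) = 2 ^ 6 by norm_num]
      exact pow_ne_zero _ h
  let c : Fin 8 → F := ![0, 1, 0, 0, 0, 1, β, 0]
  have c0 : (nonic c).coeff 0 = 0 := nonic_coeff c 0
  have c1 : (nonic c).coeff 1 = 1 := nonic_coeff c 1
  have c2 : (nonic c).coeff 2 = 0 := nonic_coeff c 2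
  have c3 : (nonic c).coeff 3 = 0 := nonic_coeff c 3
  have c4 : (nonic c).coeff 4 = 0 := nonic_coeff c 4
  have c5 : (nonic c).coeff 5 = 1 := nonic_coeff c 5
  have c6 : (nonic c).coeff 6 = β := nonic_coeff c 6
  have c7 : (nonic c).coeff 7 = 0 := nonic_coeff c 7
  have hW : curve (nonic c) = ⟨0, 0, β, 1, 0⟩ := by
    ext <;> simp [curve, shift, q₀, q₁, r₀, r₁, r₂, c0, c1, c2, c3, c4, c5, c6, c7]
  refine ⟨nonic c, nonic_monic c, nonic_natDegree c, nonic_coeff_eight c, fun h => hβ ?_⟩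
  rw [hW] at h
  simp only [WeierstrassCurve.Δ, WeierstrassCurve.b₂, WeierstrassCurve.b₄, WeierstrassCurve.b₆,
    WeierstrassCurve.b₈] at h
  linear_combination -h

end CuspidalFamily

/-! ### Generic points of affine space -/

section Generic

variable (I F : Type*) [Field F]

/-- The filter of sets containing a nonempty principal Zariski-open subset of the affine space
`F ^ I`: a property holds eventually if it holds wherever some nonzero polynomial does not
vanish. -/
def zariskiGeneric : Filter (I → F) where
  sets := {s | ∃ p : MvPolynomial I F, p ≠ 0 ∧ ∀ x, MvPolynomial.eval x p ≠ 0 → x ∈ s}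
  univ_sets := ⟨1, one_ne_zero, fun _ _ => trivial⟩
  sets_of_superset := fun ⟨p, hp, h⟩ hst => ⟨p, hp, fun x hx => hst (h x hx)⟩
  inter_sets := fun ⟨p, hp, h⟩ ⟨q, hq, h'⟩ => ⟨p * q, mul_ne_zero hp hq, fun x hx => by
    rw [map_mul, mul_ne_zero_iff] at hx
    exact ⟨h x hx.1, h' x hx.2⟩⟩

variable {I F}

theorem eventually_eval_ne_zero {p : MvPolynomial I F} {x : I → F}
    (h : MvPolynomial.eval x p ≠ 0) : ∀ᶠ y in zariskiGeneric I F, MvPolynomial.eval y p ≠ 0 :=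
  ⟨p, fun h0 => h (by rw [h0, map_zero]), fun _ hx => hx⟩

/-- Over an infinite field `K`, the `K`-span of a spanning family of vectors of `F ^ I` is
Zariski dense. -/
theorem exists_of_eventually_zariskiGeneric {K V : Type*} [Field K] [Infinite K] [Algebra K F]
    [AddCommGroup V] [Module K V] (φ : V →ₗ[K] I → F)
    (hφ : Submodule.span F (Set.range φ) = ⊤) {P : (I → F) → Prop}
    (hP : ∀ᶠ x in zariskiGeneric I F, P x) : ∃ v, P (φ v) := by
  obtain ⟨p, hp, h⟩ := hP
  suffices ∃ v, MvPolynomial.eval (φ v) p ≠ 0 from this.imp fun v hv => h _ hv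
  by_contra! hcon
  have : Infinite F := Infinite.of_injective _ (algebraMap K F).injective
  refine hp (MvPolynomial.funext fun x => ?_)
  have hx : x ∈ Submodule.span F (Set.range φ) := hφ ▸ Submodule.mem_top
  obtain ⟨n, a, w, rfl⟩ := Submodule.mem_span_set'.1 hx
  choose v hv using fun k => (w k).2
  -- the restriction of `p` to the span of the `φ (v k)`, a polynomial in the coefficients
  let q : MvPolynomial (Fin n) F := MvPolynomial.bind₁
    (fun i => ∑ k, MvPolynomial.C (φ (v k) i) * MvPolynomial.X k) p
  have hq (y : Fin n → F) :
      MvPolynomial.eval y q = MvPolynomial.eval (∑ k, y k • φ (v k)) p := by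
    have := MvPolynomial.eval₂Hom_bind₁ (RingHom.id F) y
      (fun i => ∑ k, MvPolynomial.C (φ (v k) i) * MvPolynomial.X k) p
    refine this.trans ?_
    change MvPolynomial.eval _ p = _
    congr 1
    congr 1
    ext i
    simp [mul_comm]
  have hq0 : q = 0 := by
    refine MvPolynomial.funext_set (fun _ => Set.range (algebraMap K F))
      (fun _ => Set.infinite_range_of_injective (algebraMap K F).injective) fun y hy => ?_
    choose b hb using fun k => hy k trivial
    rw [hq, map_zero, ← hcon (∑ k, b k • v k)]
    congr 2
    rw [map_sum]
    refine Finset.sum_congr rfl fun k _ => ?_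
    rw [map_smul, ← hb k, algebraMap_smul]
  have := hq a
  rw [hq0, map_zero] at this
  simp only [hv] at this
  rw [← this, map_zero]

end Generic

/-- The conjugates of the elements of a finite product of separable extensions span: this is
Dedekind's linear independence of embeddings. -/
theorem span_range_embeddings_eq_top {K F ι : Type*} [Field K] [Field F] [Algebra K F] [Fintype ι]
    (L : ι → Type*) [∀ i, Field (L i)] [∀ i, Algebra K (L i)] [∀ i, FiniteDimensional K (L i)]
    (φ : (∀ i, L i) →ₗ[K] (Σ i, L i →ₐ[K] F) → F) (hφ : ∀ a s, φ a s = s.2 (a s.1)) :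
    Submodule.span F (Set.range φ) = ⊤ := by
  classical
  by_contra hne
  obtain ⟨f, hf0, hf⟩ := Submodule.exists_le_ker_of_lt_top _ (lt_top_iff_ne_top.2 hne)
  refine hf0 (LinearMap.pi_ext' fun s => LinearMap.ext_ring ?_)
  have hsingle (s : Σ i, L i →ₐ[K] F) :
      (fun j => if s = j then (1 : F) else 0) = Pi.single s 1 := by
    ext j; simp [Pi.single_apply, eq_comm]
  obtain ⟨i, σ⟩ := s
  have hli := Fintype.linearIndependent_iff.1 (linearIndependent_toLinearMap K (L i) F)
    (fun τ => f (Pi.single ⟨i, τ⟩ 1)) ?_ σ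
  · simpa using hli
  · ext b
    have h0 : f (φ (Pi.single i b)) = 0 := hf (Submodule.subset_span ⟨_, rfl⟩)
    simp only [f.pi_apply_eq_sum_univ (φ _), hsingle] at h0
    rw [Fintype.sum_sigma, Finset.sum_eq_single i] at h0
    · simpa [hφ, mul_comm] using h0
    · intro j _ hj
      refine Finset.sum_eq_zero fun τ _ => ?_
      simp [hφ, Pi.single_eq_of_ne hj]
    · simp

/-! ### Generic members of the family -/

namespace CuspidalFamily

open Polynomial

variable {I : Type*} [Fintype I]

/-- The monic polynomial with the family of roots `θ`. -/
noncomputable def rootPoly {R : Type*} [CommRing R] (θ : I → R) : R[X] := ∏ i, (X - C (θ i))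

theorem map_rootPoly {R S : Type*} [CommRing R] [CommRing S] (f : R →+* S) (θ : I → R) :
    (rootPoly θ).map f = rootPoly (f ∘ θ) := by
  simp [rootPoly, Polynomial.map_prod]

/-- Given weights `c` with `∑ i, c i = 1`, this is the projection `x ↦ x - (∑ i, x i) • c` onto the
families of sum zero. It replaces centring, which would divide by `9`. -/
def center {R : Type*} [CommRing R] (c x : I → R) (i : I) : R := x i - (∑ j, x j) * c i

variable {F : Type*} [Field F]

theorem center_eq_self {c x : I → F} (hx : ∑ i, x i = 0) : center c x = x := by
  ext i; simp [center, hx]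

theorem sum_center {c : I → F} (hc : ∑ i, c i = 1) (x : I → F) : ∑ i, center c x i = 0 := by
  simp [center, Finset.sum_sub_distrib, ← Finset.mul_sum, hc]

theorem rootPoly_coeff_eight (hI : Fintype.card I = 9) (θ : I → F) :
    (rootPoly θ).coeff 8 = -∑ i, θ i := by
  have := prod_X_sub_C_coeff_card_pred Finset.univ θ (by simp [hI])
  rwa [Finset.card_univ, hI] at this

/-- The specializations of the family of roots: any monic polynomial of degree `9` without a term of
degree `8` is reached, with a prescribed root at a prescribed index. -/
theorem exists_rootPoly_eq [IsAlgClosed F] [DecidableEq I] (hI : Fintype.card I = 9) {g : F[X]}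
    (hm : g.Monic) (hdeg : g.natDegree = 9) (h8 : g.coeff 8 = 0) {θ : F} (hθ : g.eval θ = 0)
    (i : I) : ∃ ψ : I → F, rootPoly ψ = g ∧ ψ i = θ ∧ ∑ j, ψ j = 0 := by
  obtain ⟨ψ, hψ⟩ : ∃ ψ : I → F, rootPoly ψ = g := by
    have hg := (IsAlgClosed.splits g).eq_prod_roots_of_monic hm
    have hcard := (IsAlgClosed.splits g).natDegree_eq_card_roots
    rw [hdeg] at hcard
    obtain ⟨l, hl⟩ := Quotient.exists_rep g.roots
    rw [← hl] at hg hcard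
    let e : I ≃ Fin l.length := Fintype.equivFinOfCardEq (hI.trans hcard)
    refine ⟨fun j => l[(e j).1], ?_⟩
    rw [rootPoly, hg, Equiv.prod_comp e (fun k : Fin l.length => X - C l[k.1]),
      Fin.prod_univ_fun_getElem l (fun a => X - C a)]
    rfl
  obtain ⟨k, hk⟩ : ∃ k, ψ k = θ := by
    rw [← hψ, rootPoly, eval_prod, Finset.prod_eq_zero_iff] at hθ
    obtain ⟨k, -, hk⟩ := hθ
    exact ⟨k, by simpa [sub_eq_zero, eq_comm] using hk⟩
  have hψ' : rootPoly (ψ ∘ Equiv.swap i k) = g := by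
    rw [← hψ]
    exact Equiv.prod_comp (Equiv.swap i k) fun j => X - C (ψ j)
  refine ⟨ψ ∘ Equiv.swap i k, hψ', by simpa using hk, ?_⟩
  rw [← hψ', rootPoly_coeff_eight hI, neg_eq_zero] at h8
  exact h8

/-- The genericity conditions on a family of nine roots: they are distinct, the curve is elliptic
with `j`-invariant outside `J`, all nine points are affine and determine their parameters, and
the iterated doubles of these points, up to the `N`-th one, have distinct `x`-coordinates. -/
structure IsGood (N : ℕ) (J : Set F) (ψ : I → F) : Prop where
  injective : Function.Injective ψ
  disc_ne : (curve (rootPoly ψ)).Δ ≠ 0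
  j_ne : ∀ j ∈ J, (curve (rootPoly ψ)).c₄ ^ 3 - j * (curve (rootPoly ψ)).Δ ≠ 0
  coeff_ne : (rootPoly ψ).coeff 5 ≠ 0
  q_ne : q₀ (rootPoly ψ) ≠ 0
  tangent_ne : ∀ i, tangent (rootPoly ψ) (ψ i) ≠ 0
  secondTangent_ne : ∀ i, secondTangent (rootPoly ψ) (ψ i) ≠ 0
  multipleX_ne : ∀ i, ∀ m ∈ Finset.range (N + 1), ∀ n ∈ Finset.range m,
    (multipleX (rootPoly ψ) (ψ i) n).1 * (multipleX (rootPoly ψ) (ψ i) m).2 -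
      (multipleX (rootPoly ψ) (ψ i) m).1 * (multipleX (rootPoly ψ) (ψ i) n).2 ≠ 0

/-- Each genericity condition is the nonvanishing of a polynomial in the roots, hence holds generically
as soon as it holds somewhere: on the smooth member for the discriminant, and on the nodal member
for all the others except the distinctness of the roots. -/
theorem eventually_isGood [IsAlgClosed F] [DecidableEq I] (hI : Fintype.card I = 9) (c : I → F)
    (N : ℕ) {J : Set F} (hJ : J.Finite) :
    ∀ᶠ x in zariskiGeneric I F, IsGood N J (center c x) := by
  -- the universal family of sum zero, and the polynomial with these roots
  let Θ : I → MvPolynomial I F := center (fun i => MvPolynomial.C (c i)) MvPolynomial.X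
  let G := rootPoly Θ
  have hΘ (x : I → F) : MvPolynomial.eval x ∘ Θ = center c x := by
    ext i; simp [Θ, center]
  have hG (x : I → F) : G.map (MvPolynomial.eval x) = rootPoly (center c x) := by
    rw [map_rootPoly, hΘ]
  have hΘ' (x : I → F) (i : I) : MvPolynomial.eval x (Θ i) = center c x i := congrFun (hΘ x) i
  -- a polynomial condition which holds for one family of sum zero holds generically
  have key (p : MvPolynomial I F) (f : (I → F) → F)
      (hp : ∀ x, MvPolynomial.eval x p = f (center c x))
      (h : ∃ ψ : I → F, ∑ i, ψ i = 0 ∧ f ψ ≠ 0) :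
      ∀ᶠ x in zariskiGeneric I F, f (center c x) ≠ 0 := by
    obtain ⟨ψ, hψ, h⟩ := h
    have := eventually_eval_ne_zero (p := p) (x := ψ) (by rwa [hp, center_eq_self hψ])
    filter_upwards [this] with x hx
    rwa [← hp]
  have hW (x : I → F) : (curve G).map (MvPolynomial.eval x) =
      curve (rootPoly (center c x)) := by rw [← map_curve, hG]
  have hT (x : I → F) (i : I) : MvPolynomial.eval x (tangent G (Θ i)) =
      tangent (rootPoly (center c x)) (center c x i) := by rw [← map_tangent, hG, hΘ']
  have hZ (x : I → F) (i : I) : MvPolynomial.eval x (secondTangent G (Θ i)) =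
      secondTangent (rootPoly (center c x)) (center c x i) := by
    rw [← map_secondTangent, hG, hΘ']
  have hM (x : I → F) (i : I) (n : ℕ) : multipleX (rootPoly (center c x)) (center c x i) n =
      Prod.map (MvPolynomial.eval x) (MvPolynomial.eval x) (multipleX G (Θ i) n) := by
    rw [← map_multipleX, hG, hΘ']
  obtain ⟨g, θ, hm, hdeg, h8, hθ, hg5, hgq, hgt, hgz, hgΔ, hgc, hgd⟩ := exists_nodal F N
  have spec (i : I) := exists_rootPoly_eq hI hm hdeg h8 hθ i
  obtain ⟨i₀⟩ : Nonempty I := Fintype.card_pos_iff.1 (by omega)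
  obtain ⟨ψ₀, hψ₀, -, hsum₀⟩ := spec i₀
  -- roots `i ≠ j` are told apart by the family `1` at `i`, `-1` at a third index `k`, `0` elsewhere
  have h1 : ∀ᶠ x in zariskiGeneric I F, ∀ i j, i ≠ j → center c x i - center c x j ≠ 0 := by
    rw [Filter.eventually_all]; intro i
    rw [Filter.eventually_all]; intro j
    by_cases hij : i = j
    · simp [hij]
    · obtain ⟨k, hk⟩ : ∃ k, k ∉ ({i, j} : Finset I) := by
        by_contra! hcon
        have := Finset.card_le_card (fun k _ => hcon k : Finset.univ ⊆ ({i, j} : Finset I))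
        have h2 := Finset.card_le_two (a := i) (b := j)
        rw [Finset.card_univ] at this
        omega
      simp only [Finset.mem_insert, Finset.mem_singleton, not_or] at hk
      have := key (Θ i - Θ j) (fun ψ => ψ i - ψ j) (fun x => by rw [map_sub, hΘ', hΘ'])
        ⟨Pi.single i 1 - Pi.single k 1, by simp, by simp [Ne.symm hij, Ne.symm hk.1, Ne.symm hk.2]⟩
      filter_upwards [this] with x hx _ using hx
  have h2 := key (curve G).Δ (fun ψ => (curve (rootPoly ψ)).Δ)
    (fun x => by rw [← WeierstrassCurve.map_Δ, hW]) (by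
      obtain ⟨g', hm', hdeg', h8', hΔ⟩ := exists_smooth F
      obtain ⟨θ', hθ'⟩ := IsAlgClosed.exists_root g'
        (by rw [degree_eq_natDegree hm'.ne_zero, hdeg']; norm_num)
      obtain ⟨ψ, hψ, -, hsum⟩ := exists_rootPoly_eq hI hm' hdeg' h8' hθ' i₀
      exact ⟨ψ, hsum, by rwa [hψ]⟩)
  have h3 : ∀ᶠ x in zariskiGeneric I F, ∀ j ∈ J, (curve (rootPoly (center c x))).c₄ ^ 3 -
      j * (curve (rootPoly (center c x))).Δ ≠ 0 := by
    rw [Filter.eventually_all_finite hJ]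
    intro j _
    refine key ((curve G).c₄ ^ 3 - MvPolynomial.C j * (curve G).Δ)
      (fun ψ => (curve (rootPoly ψ)).c₄ ^ 3 - j * (curve (rootPoly ψ)).Δ) (fun x => ?_)
      ⟨ψ₀, hsum₀, ?_⟩
    · rw [← hW, WeierstrassCurve.map_c₄, WeierstrassCurve.map_Δ]; simp
    · simpa [hψ₀, hgΔ] using hgc
  have h4 := key (G.coeff 5) (fun ψ => (rootPoly ψ).coeff 5)
    (fun x => by rw [← hG, coeff_map]) ⟨ψ₀, hsum₀, by rwa [hψ₀]⟩
  have h5 := key (q₀ G) (fun ψ => q₀ (rootPoly ψ))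
    (fun x => by rw [← hG, map_q₀]) ⟨ψ₀, hsum₀, by rwa [hψ₀]⟩
  have h6 (i : I) := key (tangent G (Θ i)) (fun ψ => tangent (rootPoly ψ) (ψ i))
    (fun x => hT x i) (by
      obtain ⟨ψ, hψ, hi, hsum⟩ := spec i
      exact ⟨ψ, hsum, by rwa [hψ, hi]⟩)
  have h7 (i : I) := key (secondTangent G (Θ i)) (fun ψ => secondTangent (rootPoly ψ) (ψ i))
    (fun x => hZ x i) (by
      obtain ⟨ψ, hψ, hi, hsum⟩ := spec i
      exact ⟨ψ, hsum, by rwa [hψ, hi]⟩)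
  have h8 : ∀ᶠ x in zariskiGeneric I F, ∀ i, ∀ m ∈ Finset.range (N + 1), ∀ n ∈ Finset.range m,
      (multipleX (rootPoly (center c x)) (center c x i) n).1 *
        (multipleX (rootPoly (center c x)) (center c x i) m).2 -
      (multipleX (rootPoly (center c x)) (center c x i) m).1 *
        (multipleX (rootPoly (center c x)) (center c x i) n).2 ≠ 0 := by
    rw [Filter.eventually_all]; intro i
    rw [Filter.eventually_all_finset]; intro m hm
    rw [Filter.eventually_all_finset]; intro n hn
    obtain ⟨ψ, hψ, hi, hsum⟩ := spec i
    refine key ((multipleX G (Θ i) n).1 * (multipleX G (Θ i) m).2 -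
        (multipleX G (Θ i) m).1 * (multipleX G (Θ i) n).2)
      (fun ψ => (multipleX (rootPoly ψ) (ψ i) n).1 * (multipleX (rootPoly ψ) (ψ i) m).2 -
        (multipleX (rootPoly ψ) (ψ i) m).1 * (multipleX (rootPoly ψ) (ψ i) n).2)
      (fun x => by simp only [hM, map_sub, map_mul, Prod.map_fst, Prod.map_snd]) ⟨ψ, hsum, ?_⟩
    rw [hψ, hi]
    exact sub_ne_zero.2 (hgd m (Nat.lt_succ_iff.1 (Finset.mem_range.1 hm)) n
      (Finset.mem_range.1 hn))
  filter_upwards [h1, h2, h3, h4, h5, Filter.eventually_all.2 h6, Filter.eventually_all.2 h7, h8]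
    with x k1 k2 k3 k4 k5 k6 k7 k8
  exact ⟨fun i j hij => by_contra fun hne => k1 i j hne (sub_eq_zero.2 hij), k2, k3, k4, k5, k6, k7,
    k8⟩

end CuspidalFamily

/-! ### Points over the given extensions -/

namespace CuspidalFamily

open Polynomial

/-- If its conjugates are distinct, `θ` generates `L` over `K`, and its minimal polynomial has the
conjugates of `θ` as its roots. -/
theorem map_minpoly_eq_prod {K L Ω : Type*} [Field K] [Field L] [Field Ω] [Algebra K L]
    [Algebra K Ω] [FiniteDimensional K L] [Algebra.IsSeparable K L] [IsAlgClosed Ω] {θ : L}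
    (h : Function.Injective fun σ : L →ₐ[K] Ω => σ θ) :
    (minpoly K θ).map (algebraMap K Ω) = ∏ σ : L →ₐ[K] Ω, (X - C (σ θ)) := by
  have hmon : ((minpoly K θ).map (algebraMap K Ω)).Monic :=
    (minpoly.monic (IsIntegral.of_finite K θ)).map _
  refine eq_of_monic_of_dvd_of_natDegree_le (monic_prod_of_monic _ _ fun σ _ => monic_X_sub_C _)
    hmon ?_ ?_
  · refine Finset.prod_dvd_of_coprime ((pairwise_coprime_X_sub_C h).set_pairwise _) fun σ _ => ?_
    rw [dvd_iff_isRoot, IsRoot.def, eval_map_algebraMap, aeval_algHom_apply, minpoly.aeval,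
      map_zero]
  · rw [natDegree_prod_of_monic _ _ fun σ _ => monic_X_sub_C _]
    simpa [AlgHom.card] using minpoly.natDegree_le θ

section Points

variable {K : Type*} [Field K] {g : K[X]} {L : Type*} [Field L] [Algebra K L] {θ : L}

theorem baseChange_curve (g : K[X]) (L : Type*) [Field L] [Algebra K L] :
    (curve g).baseChange L = curve (g.map (algebraMap K L)) :=
  (map_curve _ _).symm

/-- A root of `g` in an extension `L` gives an `L`-rational point of `curve g`. -/
theorem nonsingular_point (hdeg : g.natDegree = 9) (hm : g.Monic) (h8 : g.coeff 8 = 0)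
    (hΔ : (curve g).Δ ≠ 0) (hθ : aeval θ g = 0)
    (hs : tangent (g.map (algebraMap K L)) θ ≠ 0) :
    ((curve g).baseChange L).toAffine.Nonsingular (pointX (g.map (algebraMap K L)) θ)
      (pointY (g.map (algebraMap K L)) θ) := by
  rw [baseChange_curve]
  refine (WeierstrassCurve.Affine.equation_iff_nonsingular_of_Δ_ne_zero ?_).1
    (equation_point ((natDegree_map _).trans hdeg) (hm.map _) (by simp [h8])
      (by rwa [eval_map_algebraMap]) hs)
  rw [map_curve, WeierstrassCurve.map_Δ]
  exact (_root_.map_ne_zero _).2 hΔ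

theorem map_algHom {M : Type*} [Field M] [Algebra K M] (f : L →ₐ[K] M) :
    (g.map (algebraMap K L)).map (f : L →+* M) = g.map (algebraMap K M) := by
  rw [Polynomial.map_map, f.comp_algebraMap]

/-- If the first doubles of a point have distinct `x`-coordinates over `L`, its order is large in
every extension of `L`. -/
theorem orderGT_mapPoint {N : ℕ} {P : NewPoints.RatPoint (curve g) L}
    {h : ((curve g).baseChange L).toAffine.Nonsingular (pointX (g.map (algebraMap K L)) θ)
      (pointY (g.map (algebraMap K L)) θ)}
    (hP : P = .some _ _ h) (hs : tangent (g.map (algebraMap K L)) θ ≠ 0)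
    (hne : ∀ m ≤ N, ∀ n < m,
      (multipleX (g.map (algebraMap K L)) θ n).1 * (multipleX (g.map (algebraMap K L)) θ m).2 ≠
      (multipleX (g.map (algebraMap K L)) θ m).1 * (multipleX (g.map (algebraMap K L)) θ n).2)
    {M : Type*} [Field M] [Algebra K M] (f : L →ₐ[K] M) :
    NewPoints.OrderGT (curve g) N (NewPoints.mapPoint (curve g) f P) := by
  classical
  subst hP
  refine WeierstrassCurve.not_isOfFinAddOrder_or_lt_addOrderOf
    (p := (f (-secondTangent (g.map (algebraMap K L)) θ), f (tangent (g.map (algebraMap K L)) θ)))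
    ?_ fun m hm n hn heq => hne m hm n hn (f.injective ?_)
  · change f (-secondTangent _ θ) = f (pointX _ θ) * f (tangent _ θ)
    rw [← map_mul, pointX, div_mul_cancel₀ _ hs]
  · have key (k : ℕ) : ((curve g).baseChange M).xDouble^[k]
        (f (-secondTangent (g.map (algebraMap K L)) θ), f (tangent (g.map (algebraMap K L)) θ)) =
        Prod.map (f : L →+* M) (f : L →+* M) (multipleX (g.map (algebraMap K L)) θ k) := by
      rw [multipleX, ← WeierstrassCurve.map_iterate_xDouble, ← map_curve, map_algHom,
        ← baseChange_curve]
      rfl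
    rw [key, key] at heq
    simpa using heq

/-- The parameter `θ` is a rational function of the coordinates of the point, so the point is new if
`θ` generates `L`. -/
theorem isNew_point {P : NewPoints.RatPoint (curve g) L}
    {h : ((curve g).baseChange L).toAffine.Nonsingular (pointX (g.map (algebraMap K L)) θ)
      (pointY (g.map (algebraMap K L)) θ)}
    (hP : P = .some _ _ h)
    (hrec : recover (g.map (algebraMap K L)) (pointX (g.map (algebraMap K L)) θ)
      (pointY (g.map (algebraMap K L)) θ) = θ)
    (hgen : IntermediateField.adjoin K {θ} = ⊤) : NewPoints.IsNew (curve g) P := by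
  subst hP
  rintro M ⟨Q, hQ⟩
  rw [← top_le_iff, ← hgen, IntermediateField.adjoin_simple_le_iff]
  cases Q with
  | zero => cases hQ
  | some x y hxy =>
    obtain ⟨hx, hy⟩ := WeierstrassCurve.Affine.Point.some.inj hQ
    rw [← hrec, ← hx, ← hy, ← map_algHom M.val]
    rw [show recover _ (M.val x) (M.val y) = _ from map_recover (M.val : M →+* L) _ x y]
    exact SetLike.coe_mem _

end Points

/-- The geometric `j`-invariant `c₄ ^ 3 / Δ`, as a function on all Weierstrass curves. -/
noncomputable def geomJ {K : Type*} [Field K] (E : WeierstrassCurve K) : AlgebraicClosure K :=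
  algebraMap K _ (E.c₄ ^ 3 / E.Δ)

theorem geomJ_eq_of_geomIso {K : Type*} [Field K] {E E' : WeierstrassCurve K}
    (h : NewPoints.GeomIso E E') : geomJ E = geomJ E' := by
  obtain ⟨C, hC⟩ := h
  have h4 := congrArg WeierstrassCurve.c₄ hC
  have hΔ := congrArg WeierstrassCurve.Δ hC
  rw [WeierstrassCurve.variableChange_c₄] at h4
  rw [WeierstrassCurve.variableChange_Δ] at hΔ
  simp only [WeierstrassCurve.baseChange, WeierstrassCurve.map_c₄, WeierstrassCurve.map_Δ] at h4 hΔ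
  rw [geomJ, geomJ, map_div₀, map_div₀, map_pow, map_pow, ← h4, ← hΔ, mul_pow, ← pow_mul,
    mul_div_mul_left _ _ (pow_ne_zero _ (Units.ne_zero _))]

/-- The curves of the theorem exist with `j`-invariant outside any given finite set. -/
theorem exists_curve {K : Type u} [Field K] [Infinite K] {t : ℕ}
    (L : Fin t → Type v) [∀ i, Field (L i)] [∀ i, Algebra K (L i)]
    [∀ i, FiniteDimensional K (L i)] [∀ i, Algebra.IsSeparable K (L i)]
    (hd : ∑ i, Module.finrank K (L i) = 9) (N : ℕ) {J : Set (AlgebraicClosure K)}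
    (hJ : J.Finite) :
    ∃ E : WeierstrassCurve K, geomJ E ∉ J ∧ E.IsElliptic ∧
        ∃ P : ∀ i, NewPoints.RatPoint E (L i),
          (∀ i, NewPoints.IsNew E (P i)) ∧
          (Function.Injective fun i => NewPoints.closedPoint E (P i)) ∧
          ∀ (F : Type w) [Field F] [Algebra K F] (f : ∀ i, L i →ₐ[K] F) (i : Fin t),
            NewPoints.OrderGT E N (NewPoints.mapPoint E (f i) (P i)) := by
  classical
  let Ω := AlgebraicClosure K
  let I := Σ i, L i →ₐ[K] Ω
  have hI : Fintype.card I = 9 := by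
    rw [Fintype.card_sigma, ← hd]
    exact Finset.sum_congr rfl fun i _ => AlgHom.card K (L i) Ω
  obtain ⟨⟨i₀, -⟩⟩ : Nonempty I := Fintype.card_pos_iff.1 (by omega)
  -- an element of trace `1` in the product of the `L i`
  obtain ⟨b, hb⟩ := Algebra.trace_surjective K (L i₀) 1
  let φ : (∀ i, L i) →ₗ[K] I → Ω := LinearMap.pi fun s => s.2.toLinearMap ∘ₗ LinearMap.proj s.1
  have hφ (a : ∀ i, L i) (s : I) : φ a s = s.2 (a s.1) := rfl
  have hφsum (a : ∀ i, L i) :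
      ∑ s, φ a s = algebraMap K Ω (∑ i, Algebra.trace K (L i) (a i)) := by
    rw [map_sum, Fintype.sum_sigma]
    exact Finset.sum_congr rfl fun i _ =>
      (trace_eq_sum_embeddings Ω (K := K) (x := a i)).symm
  let e : ∀ i, L i := Pi.single i₀ b
  have he : ∑ s, φ e s = 1 := by
    rw [hφsum, Finset.sum_eq_single i₀]
    · simp [e, hb]
    · intro j _ hj
      simp [e, Pi.single_eq_of_ne hj]
    · simp
  obtain ⟨a, ha⟩ := exists_of_eventually_zariskiGeneric φ
    (span_range_embeddings_eq_top L φ hφ) (eventually_isGood hI (φ e) N hJ)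
  let θ (i : Fin t) : L i := a i - algebraMap K (L i) (∑ j, Algebra.trace K (L j) (a j)) * e i
  let ψ : I → Ω := fun s => s.2 (θ s.1)
  have hψ : center (φ e) (φ a) = ψ := by
    ext s
    simp only [center, hφsum, ψ, θ, map_sub, map_mul, AlgHom.commutes]
    rfl
  have hψsum : ∑ s, ψ s = 0 := hψ ▸ sum_center he _
  rw [hψ] at ha
  have hinj (i : Fin t) : Function.Injective fun σ : L i →ₐ[K] Ω => σ (θ i) := fun σ τ h =>
    eq_of_heq (Sigma.mk.inj (ha.injective (a₁ := ⟨i, σ⟩) (a₂ := ⟨i, τ⟩) h)).2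
  let g : K[X] := ∏ i, minpoly K (θ i)
  have hg : g.map (algebraMap K Ω) = rootPoly ψ := by
    rw [Polynomial.map_prod, rootPoly, Fintype.prod_sigma]
    exact Finset.prod_congr rfl fun i _ => map_minpoly_eq_prod (hinj i)
  have hm : g.Monic := monic_prod_of_monic _ _ fun i _ => minpoly.monic (IsIntegral.of_finite K _)
  have hdeg : g.natDegree = 9 := by
    rw [← natDegree_map (algebraMap K Ω), hg, rootPoly,
      natDegree_prod_of_monic _ _ fun s _ => monic_X_sub_C _]
    simp [hI]
  have h8 : g.coeff 8 = 0 := by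
    apply (algebraMap K Ω).injective
    rw [← coeff_map, hg, rootPoly_coeff_eight hI, hψsum, neg_zero, map_zero]
  have hW : (curve g).map (algebraMap K Ω) = curve (rootPoly ψ) := by rw [← map_curve, hg]
  have hΔ : (curve g).Δ ≠ 0 := fun h => ha.disc_ne (by
    rw [← hW, WeierstrassCurve.map_Δ, h, map_zero])
  -- choice of an embedding of each `L i`, to transfer nonvanishing from `Ω`
  have σ (i : Fin t) : L i →ₐ[K] Ω := IsAlgClosed.lift
  have hgL (i : Fin t) (τ : L i →ₐ[K] Ω) :
      (g.map (algebraMap K (L i))).map (τ : L i →+* Ω) = rootPoly ψ := by rw [map_algHom, hg]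
  have hroot (i : Fin t) : aeval (θ i) g = 0 := by
    rw [map_prod]
    exact Finset.prod_eq_zero (Finset.mem_univ i) (minpoly.aeval K _)
  have h5 (i : Fin t) : (g.map (algebraMap K (L i))).coeff 5 ≠ 0 := fun h => ha.coeff_ne (by
    rw [← hgL i (σ i), coeff_map, h, map_zero])
  have hq (i : Fin t) : q₀ (g.map (algebraMap K (L i))) ≠ 0 := fun h => ha.q_ne (by
    rw [← hgL i (σ i), map_q₀, h, map_zero])
  have hs (i : Fin t) : tangent (g.map (algebraMap K (L i))) (θ i) ≠ 0 := fun h =>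
    ha.tangent_ne ⟨i, σ i⟩ (by
      rw [← hgL i (σ i)]
      exact (map_tangent (σ i : L i →+* Ω) _ _).trans (by rw [h, map_zero]))
  have hz (i : Fin t) : secondTangent (g.map (algebraMap K (L i))) (θ i) ≠ 0 := fun h =>
    ha.secondTangent_ne ⟨i, σ i⟩ (by
      rw [← hgL i (σ i)]
      exact (map_secondTangent (σ i : L i →+* Ω) _ _).trans (by rw [h, map_zero]))
  have hmul (i : Fin t) (k : ℕ) : multipleX (rootPoly ψ) (ψ ⟨i, σ i⟩) k =
      Prod.map (σ i : L i →+* Ω) (σ i : L i →+* Ω)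
        (multipleX (g.map (algebraMap K (L i))) (θ i) k) := by
    rw [← hgL i (σ i)]
    exact map_multipleX (σ i : L i →+* Ω) _ _ k
  have hrec (i : Fin t) := recover_point (h5 i) (hq i) (hs i) (hz i)
  have hns (i : Fin t) := nonsingular_point hdeg hm h8 hΔ (hroot i) (hs i)
  refine ⟨curve g, fun hj => ?_, ⟨hΔ.isUnit⟩, fun i => .some _ _ (hns i), fun i => ?_,
    fun i j hij => ?_, fun F _ _ f i => ?_⟩
  · refine ha.j_ne _ hj ?_
    rw [← hW, WeierstrassCurve.map_c₄, WeierstrassCurve.map_Δ, geomJ, ← map_mul,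
      div_mul_cancel₀ _ hΔ, map_pow, sub_self]
  · exact isNew_point rfl (hrec i) ((Field.primitive_element_iff_algHom_eq_of_eval' K Ω
      (fun x => IsAlgClosed.splits _) (θ i)).2 (hinj i))
  · have hmem : NewPoints.mapPoint (curve g) (σ i) (.some _ _ (hns i)) ∈
        NewPoints.closedPoint (curve g) (.some _ _ (hns j)) :=
      (Set.ext_iff.1 hij _).1 ⟨σ i, rfl⟩
    obtain ⟨τ, hτ⟩ := hmem
    obtain ⟨hx, hy⟩ := WeierstrassCurve.Affine.Point.some.inj hτ
    have key (k : Fin t) (ρ : L k →ₐ[K] Ω) : ψ ⟨k, ρ⟩ = recover (rootPoly ψ)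
        (ρ (pointX (g.map (algebraMap K (L k))) (θ k)))
        (ρ (pointY (g.map (algebraMap K (L k))) (θ k))) := by
      rw [← hgL k ρ]
      refine Eq.trans ?_ (map_recover (ρ : L k →+* Ω) _ _ _).symm
      rw [hrec]; rfl
    have hij' : ψ ⟨j, τ⟩ = ψ ⟨i, σ i⟩ := by
      rw [key, key]
      exact congrArg₂ _ hx hy
    exact (Sigma.mk.inj (ha.injective hij')).1.symm
  · refine orderGT_mapPoint rfl (hs i) (fun m hm n hn heq => ?_) (f i)
    refine ha.multipleX_ne ⟨i, σ i⟩ m (Finset.mem_range.2 (Nat.lt_succ_of_le hm)) n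
      (Finset.mem_range.2 hn) ?_
    rw [hmul, hmul, sub_eq_zero]
    simpa using congrArg (σ i) heq

end CuspidalFamily

theorem theorem6p4 {K : Type u} [Field K] [Infinite K] {t : ℕ}
    (L : Fin t → Type v) [∀ i, Field (L i)] [∀ i, Algebra K (L i)]
    [∀ i, FiniteDimensional K (L i)] [∀ i, Algebra.IsSeparable K (L i)]
    (hd : ∑ i, Module.finrank K (L i) = 9) (N : ℕ) (hN : 1 < N) :
    ∃ S : Set (WeierstrassCurve K), S.Infinite ∧
      (S.Pairwise fun E E' => ¬ NewPoints.GeomIso E E') ∧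
      ∀ E ∈ S, E.IsElliptic ∧
        ∃ P : ∀ i, NewPoints.RatPoint E (L i),
          (∀ i, NewPoints.IsNew E (P i)) ∧
          (Function.Injective fun i => NewPoints.closedPoint E (P i)) ∧
          ∀ (F : Type w) [Field F] [Algebra K F] [FiniteDimensional K F]
            (f : ∀ i, L i →ₐ[K] F),
            ∃ i, NewPoints.OrderGT E N (NewPoints.mapPoint E (f i) (P i)) := by
  have i₀ : Fin t := by
    rcases t with _ | t
    · simp at hd
    · exact 0
  let T : Set (WeierstrassCurve K) := {E | E.IsElliptic ∧
    ∃ P : ∀ i, NewPoints.RatPoint E (L i),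
      (∀ i, NewPoints.IsNew E (P i)) ∧
      (Function.Injective fun i => NewPoints.closedPoint E (P i)) ∧
      ∀ (F : Type w) [Field F] [Algebra K F] [FiniteDimensional K F]
        (f : ∀ i, L i →ₐ[K] F),
        ∃ i, NewPoints.OrderGT E N (NewPoints.mapPoint E (f i) (P i))}
  have hT : (CuspidalFamily.geomJ '' T).Infinite := fun hfin => by
    obtain ⟨E, hj, hE, P, hnew, hinj, hord⟩ := CuspidalFamily.exists_curve.{u, v, w} L hd N hfin
    exact hj ⟨E, ⟨hE, P, hnew, hinj, fun F _ _ _ f => ⟨i₀, hord F f i₀⟩⟩, rfl⟩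
  obtain ⟨S, hST, hS⟩ := Set.exists_subset_bijOn T CuspidalFamily.geomJ
  refine ⟨S, fun hfin => hT (hS.image_eq ▸ hfin.image _), fun E hE E' hE' hne hiso => ?_,
    fun E hE => hST hE⟩
  exact hne (hS.injOn hE hE' (CuspidalFamily.geomJ_eq_of_geomIso hiso))
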